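/- Let $g\ge 1$ and let $H=\mathbb{Q}^{2g}$ be the rational first homology of a compact oriented surface of genus $g$ with one boundary component, with symplectic basis $e_1,\dots,e_{2g}$ and intersection form $\langle e_i,e_{2g+1-i}\rangle=1$ for $1\le i\le g$, $=-1$ for $g<i\le 2g$, and $\langle e_i,e_j\rangle=0$ for $j\neq 2g+1-i$. For $a\in H$ put $a^*=\langle a,\cdot\rangle\in H^*$. Let $\mathcal{L}=\bigoplus_{m\ge1}\mathcal{L}(m)$ be the free Lie algebra over $\mathbb{Q}$ generated by $H=\mathcal{L}(1)$, with its canonical embedding $\mathcal{L}(m)\hookrightarrow H^{\otimes m}$. For $k\ge 1$ let $$\mathfrak{h}_{g,1}^{\mathbb{Q}}(k)=\ker\bigl(H\otimes\mathcal{L}(k+1)\to\mathcal{L}(k+2),\ X\otimes u\mapsto[X,u]\bigr)\subset H\otimes H^{\otimes (k+1)}=H^{\otimes(k+2)}.$$ For $m\ge 0$ let $\mathcal{C}(m)$ be the quotient of $H^{\otimes m}$ by the span of all $a_1\otimes a_2\otimes\cdots\otimes a_m-a_2\otimes\cdots\otimes a_m\otimes a_1$, and let $\pi:H^{\otimes m}\to\mathcal{C}(m)$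 be the projection. The Enomoto–Satoh trace map $c_k:\mathfrak{h}_{g,1}^{\mathbb{Q}}(k)\to\mathcal{C}(k)$ is the restriction of the linear map $H^{\otimes(k+2)}\to\mathcal{C}(k)$, $$a_1\otimes\cdots\otimes a_{k+2}\mapsto a_1^*(a_2)\,\pi(a_3\otimes\cdots\otimes a_{k+2}).$$ The Kawazumi–Kuno map $\delta_k^{\mathrm{alg}}:\mathfrak{h}_{g,1}^{\mathbb{Q}}(k)\to\bigoplus_{p,q\ge1,\,p+q=k}\mathcal{C}(p)\otimes\mathcal{C}(q)$ is the restriction of the linear map on $H^{\otimes(k+2)}$ that sends $a_1\otimes\cdots\otimes a_{k+2}$ to $$\sum_{\substack{1\le i<j\le k+2\\ 1<j-i<k+1}}a_i^*(a_j)\,\bigl\{A_{ij}\otimes B_{ij}-B_{ij}\otimes A_{ij}\bigr\},$$ where $A_{ij}=\pi(a_{i+1}\otimes\cdots\otimes a_{j-1})$ and $B_{ij}=\pi(a_{j+1}\otimes\cdots\otimes a_{k+2}\otimes a_1\otimes\cdots\otimes a_{i-1})$. Theorem. For every $k\ge1$ and every $g$ with $2g\ge k+2$, one has $\ker(c_k)\subset\ker(\delta_k^{\mathrm{alg}})$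 in $\mathfrak{h}_{g,1}^{\mathbb{Q}}(k)$. -/

import Mathlib

open scoped TensorProduct DirectSum

noncomputable section

namespace JohnsonCokernel

/-! ### The symplectic space `H` -/

/-- `H g` is the rational first homology of a compact oriented surface of genus `g` with one
boundary component, written in a symplectic basis `e₁, …, e_{2g}`. -/
abbrev H (g : ℕ) : Type := Fin (2 * g) → ℚ

/-- Matrix of the intersection form in the symplectic basis: `⟨e_i, e_{i'}⟩ = 1` for
`1 ≤ i ≤ g` and `-1` for `g < i ≤ 2g`, where `i' = 2g + 1 - i`; all other entries vanish. -/
def J (g : ℕ) : Matrix (Fin (2 * g)) (Fin (2 * g)) ℚ :=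
  Matrix.of fun i j => if j = i.rev then (if (i : ℕ) < g then 1 else -1) else 0

/-- The intersection form `⟨ , ⟩` on `H g`. As a linear map `H → H*`, `v ↦ ⟨v, •⟩`, it is
Poincaré duality. -/
def interForm (g : ℕ) : LinearMap.BilinForm ℚ (H g) := Matrix.toBilin' (J g)

/-! ### The free Lie algebra on `H` and its embedding in the tensor algebra -/

/-- The free Lie algebra over `ℚ` on the basis `e₁, …, e_{2g}` of `H g`. -/
abbrev FreeLie (g : ℕ) : Type := FreeLieAlgebra ℚ (Fin (2 * g))

/-- The inclusion `H → 𝓛` of the generators. -/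
def gen (g : ℕ) : H g →ₗ[ℚ] FreeLie g :=
  (Pi.basisFun ℚ (Fin (2 * g))).constr ℚ (FreeLieAlgebra.of ℚ)

/-- `lieDeg g m` is the homogeneous component `𝓛(m)`, `m ≥ 1`: the span of the simple commutators
`[a₁, a₂, …, a_m] = [⋯[[a₁, a₂], a₃], …, a_m]` with `a_i ∈ H`. -/
def lieDeg (g : ℕ) : ℕ → Submodule ℚ (FreeLie g)
  | 0 => ⊥
  | 1 => LinearMap.range (gen g)
  | m + 2 => Submodule.span ℚ {z | ∃ u ∈ lieDeg g (m + 1), ∃ a : H g, z = ⁅u, gen g a⁆}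

section

attribute [local instance] LieRing.ofAssociativeRing

/-- The Lie homomorphism from the free Lie algebra to the tensor algebra (with the commutator
bracket) extending the inclusion of `H`. -/
def lieToTensor (g : ℕ) : FreeLie g →ₗ[ℚ] TensorAlgebra ℚ (H g) :=
  (FreeLieAlgebra.lift ℚ (fun i => TensorAlgebra.ι ℚ (Pi.single i 1 : H g)) :
    FreeLie g →ₗ⁅ℚ⁆ TensorAlgebra ℚ (H g))

end

/-- The canonical embedding `𝓛(m) → H^{⊗ m}`. -/
def lieEmb (g m : ℕ) : lieDeg g m →ₗ[ℚ] ⨂[ℚ]^m (H g) :=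
  DirectSum.component ℚ ℕ (fun n => ⨂[ℚ]^n (H g)) m ∘ₗ
    (TensorAlgebra.equivDirectSum (R := ℚ) (M := H g)).toLinearMap ∘ₗ
      lieToTensor g ∘ₗ (lieDeg g m).subtype

/-! ### Symplectic derivations -/

/-- The bracket `H ⊗ 𝓛(k+1) → 𝓛`, `X ⊗ u ↦ [X, u]` (its values lie in `𝓛(k+2)`). -/
def bracketMap (g k : ℕ) : H g ⊗[ℚ] lieDeg g (k + 1) →ₗ[ℚ] FreeLie g :=
  TensorProduct.lift
    ((LieModule.toEnd ℚ (FreeLie g) (FreeLie g) : FreeLie g →ₗ[ℚ] Module.End ℚ (FreeLie g)).compl₁₂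
      (gen g) (lieDeg g (k + 1)).subtype)

/-- The degree `k` part `𝔥_{g,1}(k)` of the Lie algebra of symplectic derivations. -/
def symplDer (g k : ℕ) : Submodule ℚ (H g ⊗[ℚ] lieDeg g (k + 1)) :=
  LinearMap.ker (bracketMap g k)

/-! ### Cyclic tensors -/

/-- The span of `a₁ ⊗ a₂ ⊗ ⋯ ⊗ a_m - a₂ ⊗ ⋯ ⊗ a_m ⊗ a₁`. -/
def cyclicRel (g m : ℕ) : Submodule ℚ (⨂[ℚ]^m (H g)) :=
  Submodule.span ℚ (Set.range fun a : Fin m → H g =>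
    PiTensorProduct.tprod ℚ a - PiTensorProduct.tprod ℚ (fun i => a (finRotate m i)))

/-- The module `𝓒(m)` of cyclic coinvariants of `H^{⊗ m}`. -/
def Cyc (g m : ℕ) : Type := (⨂[ℚ]^m (H g)) ⧸ cyclicRel g m

instance (g m : ℕ) : AddCommGroup (Cyc g m) :=
  inferInstanceAs (AddCommGroup ((⨂[ℚ]^m (H g)) ⧸ cyclicRel g m))

instance (g m : ℕ) : Module ℚ (Cyc g m) :=
  inferInstanceAs (Module ℚ ((⨂[ℚ]^m (H g)) ⧸ cyclicRel g m))

/-- The projection `π_m : H^{⊗ m} → 𝓒(m)`. -/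
def cycProj (g m : ℕ) : ⨂[ℚ]^m (H g) →ₗ[ℚ] Cyc g m := (cyclicRel g m).mkQ

/-! ### The Enomoto–Satoh trace map -/

/-- The contraction `f ⊗ a₁ ⊗ ⋯ ⊗ a_{k+1} ↦ f(a₁) a₂ ⊗ ⋯ ⊗ a_{k+1}`. -/
def contract (g k : ℕ) :
    Module.Dual ℚ (H g) ⊗[ℚ] ⨂[ℚ]^(k + 1) (H g) →ₗ[ℚ] ⨂[ℚ]^k (H g) :=
  TensorProduct.lift
    { toFun := fun f => PiTensorProduct.lift
        (LinearMap.uncurryLeft (M := fun _ : Fin (k + 1) => H g)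
          (f.smulRight (PiTensorProduct.tprod ℚ)))
      map_add' := fun f f' => by
        ext a
        simp [add_smul]
      map_smul' := fun c f => by
        ext a
        simp [mul_smul] }

theorem contract_tmul_tprod (g k : ℕ) (f : Module.Dual ℚ (H g)) (a : Fin (k + 1) → H g) :
    contract g k (f ⊗ₜ PiTensorProduct.tprod ℚ a) =
      f (a 0) • PiTensorProduct.tprod ℚ (fun i : Fin k => a i.succ) := by
  simp [contract, Fin.tail_def]

/-- The Enomoto–Satoh trace map
`c_k : 𝔥_{g,1}(k) ⊂ H ⊗ 𝓛(k+1) ≅ H* ⊗ 𝓛(k+1) ⊂ H* ⊗ H^{⊗(k+1)} → H^{⊗ k} → 𝓒(k)`. -/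
def traceMap (g k : ℕ) : symplDer g k →ₗ[ℚ] Cyc g k :=
  cycProj g k ∘ₗ contract g k ∘ₗ
    TensorProduct.map (interForm g) (lieEmb g (k + 1)) ∘ₗ (symplDer g k).subtype

/-! ### The Kawazumi–Kuno map -/

/-- The pairs `(p, q)` with `p, q ≥ 1` and `p + q = k`. -/
abbrev Bidegree (k : ℕ) : Type := {pq : ℕ × ℕ // 1 ≤ pq.1 ∧ 1 ≤ pq.2 ∧ pq.1 + pq.2 = k}

/-- The target `⨁_{p,q ≥ 1, p+q=k} 𝓒(p) ⊗ 𝓒(q)`. -/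
abbrev CycCyc (g k : ℕ) : Type := ⨁ d : Bidegree k, Cyc g d.1.1 ⊗[ℚ] Cyc g d.1.2

/-- The inclusion of the summand `𝓒(p) ⊗ 𝓒(q)`. -/
def cycIncl (g : ℕ) {k p q : ℕ} (h : 1 ≤ p ∧ 1 ≤ q ∧ p + q = k) :
    Cyc g p ⊗[ℚ] Cyc g q →ₗ[ℚ] CycCyc g k :=
  DirectSum.lof ℚ (Bidegree k) (fun d => Cyc g d.1.1 ⊗[ℚ] Cyc g d.1.2) ⟨(p, q), h⟩

/-- The pairs of positions `i < j` among `k + 2` (numbered from `0`) with `1 < j - i < k + 1`. -/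
abbrev Chord (k : ℕ) : Type :=
  {c : Fin (k + 2) × Fin (k + 2) //
    c.1 < c.2 ∧ 1 < (c.2 : ℕ) - (c.1 : ℕ) ∧ (c.2 : ℕ) - (c.1 : ℕ) < k + 1}

namespace Chord

variable {k : ℕ} (c : Chord k)

/-- The number of positions strictly between `i` and `j`. -/
def inLen : ℕ := (c.1.2 : ℕ) - (c.1.1 : ℕ) - 1

/-- The number of positions after `j` or before `i`. -/
def outLen : ℕ := k + 1 - ((c.1.2 : ℕ) - (c.1.1 : ℕ))

/-- The positions `i+1, …, j-1`. -/
def inPos (t : Fin c.inLen) : Fin (k + 2) :=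
  ⟨c.1.1 + 1 + t, by
    obtain ⟨⟨i, j⟩, h1, h2, h3⟩ := c
    have ht := t.2
    have := j.2
    simp only [inLen] at *
    omega⟩

/-- The positions `j+1, …, k+2, 1, …, i-1` in this cyclic order (here numbered from `0`). -/
def outPos (t : Fin c.outLen) : Fin (k + 2) :=
  ⟨if (c.1.2 : ℕ) + 1 + t < k + 2 then (c.1.2 : ℕ) + 1 + t else (c.1.2 : ℕ) + 1 + t - (k + 2), by
    obtain ⟨⟨i, j⟩, h1, h2, h3⟩ := c
    have ht := t.2
    have := j.2
    simp only [outLen] at *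
    split_ifs <;> omega⟩

theorem lens : 1 ≤ c.inLen ∧ 1 ≤ c.outLen ∧ c.inLen + c.outLen = k := by
  obtain ⟨⟨i, j⟩, h1, h2, h3⟩ := c
  simp only at h1 h2 h3
  simp only [inLen, outLen]
  omega

theorem lens_swap : 1 ≤ c.outLen ∧ 1 ≤ c.inLen ∧ c.outLen + c.inLen = k := by
  have := c.lens
  omega

/-- The positions `i`, `j`, the inner and the outer ones, taken together. -/
def pos : Fin 2 ⊕ (Fin c.inLen ⊕ Fin c.outLen) → Fin (k + 2) :=
  Sum.elim ![c.1.1, c.1.2] (Sum.elim c.inPos c.outPos)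

theorem pos_bijective : Function.Bijective c.pos := by
  rw [Fintype.bijective_iff_injective_and_card]
  obtain ⟨⟨i, j⟩, h1, h2, h3⟩ := c
  have hij : (i : ℕ) < j := h1
  have hj := j.2
  simp only at h2 h3
  constructor
  · rintro (x | x | x) (y | y | y) h <;>
      (first | (fin_cases x) | (have hx := x.2; simp only [inLen, outLen] at hx)) <;>
      (first | (fin_cases y) | (have hy := y.2; simp only [inLen, outLen] at hy)) <;>
      simp [pos, inPos, outPos, Fin.ext_iff] at h ⊢ <;>
      (try split_ifs at h) <;> omega
  · simp only [Fintype.card_sum, Fintype.card_fin]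
    simp only [inLen, outLen]
    omega

/-- The resulting partition of the `k + 2` positions. -/
def posEquiv : Fin 2 ⊕ (Fin c.inLen ⊕ Fin c.outLen) ≃ Fin (k + 2) :=
  Equiv.ofBijective c.pos c.pos_bijective

end Chord

/-- `(a, b) ↦ ⟨a, b⟩` as a multilinear map. -/
def interMulti (g : ℕ) : MultilinearMap ℚ (fun _ : Fin 2 => H g) ℚ :=
  MultilinearMap.mk' (fun v => interForm g (v 0) (v 1))
    (fun v i x y => by fin_cases i <;> simp)
    (fun v i c x => by fin_cases i <;> simp)

/-- The multilinear map
`(a₁, …, a_{k+2}) ↦ a_i^*(a_j) π(a_{i+1} ⊗ ⋯ ⊗ a_{j-1}) ⊗ π(a_{j+1} ⊗ ⋯ ⊗ a_{k+2} ⊗ a₁ ⊗ ⋯ ⊗ a_{i-1})`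
attached to `i < j`. -/
def chordTerm (g : ℕ) {k : ℕ} (c : Chord k) :
    MultilinearMap ℚ (fun _ : Fin (k + 2) => H g) (Cyc g c.inLen ⊗[ℚ] Cyc g c.outLen) :=
  (TensorProduct.lid ℚ _).toLinearMap.compMultilinearMap
    (((interMulti g).domCoprod
      (((cycProj g c.inLen).compMultilinearMap (PiTensorProduct.tprod ℚ)).domCoprod
        ((cycProj g c.outLen).compMultilinearMap (PiTensorProduct.tprod ℚ)))).domDomCongr
      c.posEquiv)

theorem chordTerm_apply (g : ℕ) {k : ℕ} (c : Chord k) (a : Fin (k + 2) → H g) :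
    chordTerm g c a = interForm g (a c.1.1) (a c.1.2) •
      (cycProj g c.inLen (PiTensorProduct.tprod ℚ fun t => a (c.inPos t)) ⊗ₜ[ℚ]
        cycProj g c.outLen (PiTensorProduct.tprod ℚ fun t => a (c.outPos t))) := by
  rfl

/-- The Kawazumi–Kuno map on `H^{⊗(k+2)}`. -/
def deltaTensor (g k : ℕ) : ⨂[ℚ]^(k + 2) (H g) →ₗ[ℚ] CycCyc g k :=
  ∑ c : Chord k,
    (cycIncl g c.lens ∘ₗ
        PiTensorProduct.lift (chordTerm g c) -
      cycIncl g c.lens_swap ∘ₗ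
        (TensorProduct.comm ℚ (Cyc g c.inLen) (Cyc g c.outLen)).toLinearMap ∘ₗ
          PiTensorProduct.lift (chordTerm g c))

theorem deltaTensor_tprod (g k : ℕ) (a : Fin (k + 2) → H g) :
    deltaTensor g k (PiTensorProduct.tprod ℚ a) =
      ∑ c : Chord k, interForm g (a c.1.1) (a c.1.2) •
        (cycIncl g c.lens
            (cycProj g c.inLen (PiTensorProduct.tprod ℚ fun t => a (c.inPos t)) ⊗ₜ[ℚ]
              cycProj g c.outLen (PiTensorProduct.tprod ℚ fun t => a (c.outPos t))) -
          cycIncl g c.lens_swap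
            (cycProj g c.outLen (PiTensorProduct.tprod ℚ fun t => a (c.outPos t)) ⊗ₜ[ℚ]
              cycProj g c.inLen (PiTensorProduct.tprod ℚ fun t => a (c.inPos t)))) := by
  simp only [deltaTensor, LinearMap.sum_apply, LinearMap.sub_apply, LinearMap.comp_apply,
    PiTensorProduct.lift.tprod, chordTerm_apply, map_smul, smul_sub, LinearEquiv.coe_coe,
    TensorProduct.comm_tmul]

/-- The identification `H ⊗ H^{⊗ m} = H^{⊗(m+1)}`, `X ⊗ (a₁ ⊗ ⋯ ⊗ a_m) ↦ X ⊗ a₁ ⊗ ⋯ ⊗ a_m`. -/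
def consTensor (g m : ℕ) : H g ⊗[ℚ] ⨂[ℚ]^m (H g) →ₗ[ℚ] ⨂[ℚ]^(m + 1) (H g) :=
  TensorProduct.lift
    ((PiTensorProduct.lift (R := ℚ) (s := fun _ : Fin m => H g)
        (E := ⨂[ℚ]^(m + 1) (H g))).toLinearMap ∘ₗ
      (PiTensorProduct.tprod ℚ (s := fun _ : Fin (m + 1) => H g)).curryLeft)

theorem consTensor_tmul_tprod (g m : ℕ) (x : H g) (a : Fin m → H g) :
    consTensor g m (x ⊗ₜ PiTensorProduct.tprod ℚ a) =
      PiTensorProduct.tprod ℚ (Fin.cons x a : Fin (m + 1) → H g) := by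
  simp [consTensor]

/-- The Kawazumi–Kuno map `δ_k^{alg}` restricted to
`𝔥_{g,1}(k) ⊂ H ⊗ 𝓛(k+1) ⊂ H ⊗ H^{⊗(k+1)} = H^{⊗(k+2)}`. -/
def deltaAlg (g k : ℕ) : symplDer g k →ₗ[ℚ] CycCyc g k :=
  deltaTensor g k ∘ₗ consTensor g (k + 1) ∘ₗ
    TensorProduct.map LinearMap.id (lieEmb g (k + 1)) ∘ₗ (symplDer g k).subtype

end JohnsonCokernel

end

/-! Up to the factor `k + 2`, the Kawazumi–Kuno map on symplectic derivations factors through the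
Enomoto–Satoh trace; this is `deltaAlg_eq`, and the inclusion of kernels is immediate from it.

Being killed by the bracket means being invariant under rotation of the `k + 2` tensor factors
(`rot_symplDer`). The two terms attached to a chord are its two orientations, so the full map is the
sum over all rotations of the part `deltaFirst` whose chords issue from the first position. On
invariant tensors all `k + 2` summands agree (`deltaTensor_of_rot_eq`).

On `X ⊗ u`, `deltaFirst` cuts `u` at each letter and pairs that letter with `X`: it applies the
double derivation of `T(H)` extending `X^*`, then projects to cyclic words
(`deltaFirst_consTensor`). The key point is `doubleDer_lieToTensor`: if `u` is a Lie element, this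
double derivation is recovered from the contraction of the first letter alone, by applying `(S ⊗
1)Δ` (coproduct, then antipode `S` on the left factor). Since `(S ⊗ 1)Δ` is an algebra homomorphism
to `T(H)ᵐᵒᵖ ⊗ T(H)` and the projection to cyclic words is a trace there, the composite depends only
on the cyclic class of the contracted tensor (`cycCoprod_powIncl_eq_zero`), and that class is the
trace map. -/

noncomputable section

namespace JohnsonCokernel

open TensorAlgebra (ι)

/-- The tensor algebra on `H g`. -/
abbrev TA (g : ℕ) : Type := TensorAlgebra ℚ (H g)

/-! ### Tensor powers inside the tensor algebra -/

/-- The inclusion `H^{⊗ n} → T(H)`. -/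
def powIncl (g n : ℕ) : ⨂[ℚ]^n (H g) →ₗ[ℚ] TA g := TensorPower.toTensorAlgebra

/-- The projection `T(H) → H^{⊗ n}`. -/
def powProj (g n : ℕ) : TA g →ₗ[ℚ] ⨂[ℚ]^n (H g) :=
  DirectSum.component ℚ ℕ (fun n => ⨂[ℚ]^n (H g)) n ∘ₗ
    (TensorAlgebra.equivDirectSum (R := ℚ) (M := H g)).toLinearMap

theorem powIncl_tprod {g n : ℕ} (a : Fin n → H g) :
    powIncl g n (PiTensorProduct.tprod ℚ a) = (List.ofFn fun i => ι ℚ (a i)).prod := by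
  rw [powIncl, TensorPower.toTensorAlgebra_tprod, TensorAlgebra.tprod_apply]

theorem powIncl_tprod_cons {g n : ℕ} (x : H g) (a : Fin n → H g) :
    powIncl g (n + 1) (PiTensorProduct.tprod ℚ (Fin.cons x a : Fin (n + 1) → H g)) =
      ι ℚ x * powIncl g n (PiTensorProduct.tprod ℚ a) := by
  simp only [powIncl_tprod, List.ofFn_succ, List.prod_cons, Fin.cons_zero, Fin.cons_succ]

theorem powIncl_tprod_snoc {g n : ℕ} (x : H g) (a : Fin n → H g) :
    powIncl g (n + 1) (PiTensorProduct.tprod ℚ (Fin.snoc a x : Fin (n + 1) → H g)) =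
      powIncl g n (PiTensorProduct.tprod ℚ a) * ι ℚ x := by
  simp only [powIncl_tprod, List.ofFn_succ', List.concat_eq_append, List.prod_append,
    List.prod_singleton, Fin.snoc_castSucc, Fin.snoc_last]

theorem powProj_powIncl_comp (g n m : ℕ) :
    powProj g m ∘ₗ powIncl g n =
      DirectSum.component ℚ ℕ (fun n => ⨂[ℚ]^n (H g)) m ∘ₗ
        DirectSum.lof ℚ ℕ (fun n => ⨂[ℚ]^n (H g)) n := by
  refine PiTensorProduct.ext (MultilinearMap.ext fun a => ?_)
  simp only [LinearMap.compMultilinearMap_apply, LinearMap.comp_apply, powProj, powIncl,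
    TensorPower.toTensorAlgebra_tprod, AlgEquiv.toLinearMap_apply,
    TensorAlgebra.equivDirectSum_apply, TensorAlgebra.toDirectSum_tensorPower_tprod,
    DirectSum.lof_eq_of]

theorem powProj_powIncl {g n : ℕ} (x : ⨂[ℚ]^n (H g)) : powProj g n (powIncl g n x) = x := by
  have := LinearMap.congr_fun (powProj_powIncl_comp g n n) x
  simpa only [LinearMap.comp_apply, DirectSum.component.lof_self] using this

theorem powProj_powIncl_of_ne {g n m : ℕ} (h : n ≠ m) (x : ⨂[ℚ]^n (H g)) :
    powProj g m (powIncl g n x) = 0 := by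
  have := LinearMap.congr_fun (powProj_powIncl_comp g n m) x
  rw [LinearMap.comp_apply] at this
  rw [this, LinearMap.comp_apply, DirectSum.component.of, dif_neg h]

theorem powIncl_injective (g n : ℕ) : Function.Injective (powIncl g n) :=
  Function.LeftInverse.injective powProj_powIncl

theorem span_powIncl_tprod (g : ℕ) :
    Submodule.span ℚ {z : TA g | ∃ n, ∃ a : Fin n → H g,
      z = powIncl g n (PiTensorProduct.tprod ℚ a)} = ⊤ := by
  rw [eq_top_iff]
  rintro x -
  rw [← TensorAlgebra.ofDirectSum_toDirectSum x]
  induction TensorAlgebra.toDirectSum x using DirectSum.induction_on with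
  | zero => simp
  | add y z hy hz => rw [map_add]; exact add_mem hy hz
  | of n y =>
    induction y using PiTensorProduct.induction_on with
    | add y z hy hz => rw [map_add, map_add]; exact add_mem hy hz
    | smul_tprod r a =>
      rw [← DirectSum.lof_eq_of ℚ, map_smul, map_smul, DirectSum.lof_eq_of,
        TensorAlgebra.ofDirectSum_of_tprod]
      refine Submodule.smul_mem _ _ (Submodule.subset_span ⟨n, a, ?_⟩)
      rw [powIncl, TensorPower.toTensorAlgebra_tprod]

/-! ### Words -/

/-- The word `b_s b_{s+1} ⋯ b_{s+n-1}` in the tensor algebra. -/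
def word {g : ℕ} (b : ℕ → H g) (s n : ℕ) : TA g :=
  powIncl g n (PiTensorProduct.tprod ℚ fun t : Fin n => b (s + t))

theorem word_zero {g : ℕ} (b : ℕ → H g) (s : ℕ) : word b s 0 = 1 := by
  simp [word, powIncl_tprod]

theorem word_succ {g : ℕ} (b : ℕ → H g) (s n : ℕ) :
    word b s (n + 1) = word b s n * ι ℚ (b (s + n)) := by
  rw [word, word, ← powIncl_tprod_snoc]
  congr 2
  funext t
  refine Fin.lastCases ?_ (fun t => ?_) t <;> simp

/-! ### Projection to cyclic tensors -/

/-- The projection `T(H) → 𝓒(p)`. -/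
def algCyc (g p : ℕ) : TA g →ₗ[ℚ] Cyc g p := cycProj g p ∘ₗ powProj g p

theorem cycProj_tprod_finRotate {g m : ℕ} (a : Fin m → H g) :
    cycProj g m (PiTensorProduct.tprod ℚ fun i => a (finRotate m i)) =
      cycProj g m (PiTensorProduct.tprod ℚ a) := by
  symm
  exact (Submodule.Quotient.eq (cyclicRel g m)).2 (Submodule.subset_span ⟨a, rfl⟩)

/-- On a pure tensor of total degree `p`, moving the first letter to the end is the defining
rotation; in every other degree both sides are zero. -/
theorem algCyc_ι_mul {g p : ℕ} (x : H g) (y : TA g) :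
    algCyc g p (ι ℚ x * y) = algCyc g p (y * ι ℚ x) := by
  have hy : y ∈ (⊤ : Submodule ℚ (TA g)) := trivial
  rw [← span_powIncl_tprod] at hy
  induction hy using Submodule.span_induction with
  | zero => simp
  | add y z _ _ hy hz => rw [mul_add, add_mul, map_add, map_add, hy, hz]
  | smul r y _ hy => rw [mul_smul_comm, smul_mul_assoc, map_smul, map_smul, hy]
  | mem y hy =>
    obtain ⟨n, a, rfl⟩ := hy
    rw [← powIncl_tprod_cons, ← powIncl_tprod_snoc, algCyc, LinearMap.comp_apply,
      LinearMap.comp_apply]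
    rcases eq_or_ne (n + 1) p with rfl | h
    · rw [powProj_powIncl, powProj_powIncl, Fin.snoc_eq_cons_rotate, cycProj_tprod_finRotate]
    · rw [powProj_powIncl_of_ne h, powProj_powIncl_of_ne h]

theorem algCyc_mul_comm {g p : ℕ} (x y : TA g) : algCyc g p (x * y) = algCyc g p (y * x) := by
  induction x using TensorAlgebra.induction generalizing y with
  | algebraMap r => rw [Algebra.commutes]
  | ι x => exact algCyc_ι_mul x y
  | mul x z hx hz => rw [mul_assoc, hx, mul_assoc, hz, mul_assoc]
  | add x z hx hz => rw [add_mul, mul_add, map_add, map_add, hx, hz]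

/-- The projection of `T(H) ⊗ T(H)` to the sum of the `𝓒(p) ⊗ 𝓒(q)` with `p, q ≥ 1`, `p + q = k`. -/
def algCycCyc (g k : ℕ) : TA g ⊗[ℚ] TA g →ₗ[ℚ] CycCyc g k :=
  ∑ d ∈ Finset.HasAntidiagonal.antidiagonal k,
    if h : 1 ≤ d.1 ∧ 1 ≤ d.2 ∧ d.1 + d.2 = k then
      cycIncl g h ∘ₗ TensorProduct.map (algCyc g d.1) (algCyc g d.2)
    else 0

theorem algCycCyc_powIncl {g k p q : ℕ} (h : 1 ≤ p ∧ 1 ≤ q ∧ p + q = k) (x : ⨂[ℚ]^p (H g))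
    (y : ⨂[ℚ]^q (H g)) :
    algCycCyc g k (powIncl g p x ⊗ₜ powIncl g q y) =
      cycIncl g h (cycProj g p x ⊗ₜ cycProj g q y) := by
  rw [algCycCyc, LinearMap.sum_apply, Finset.sum_eq_single (p, q)]
  · rw [dif_pos h, LinearMap.comp_apply, TensorProduct.map_tmul, algCyc, LinearMap.comp_apply,
      powProj_powIncl, algCyc, LinearMap.comp_apply, powProj_powIncl]
  · rintro ⟨p', q'⟩ - hne
    split_ifs with h'
    · rw [LinearMap.comp_apply, TensorProduct.map_tmul]
      have : p ≠ p' := by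
        rintro rfl
        exact hne (Prod.ext rfl (by simp only at h' ⊢; omega))
      rw [algCyc, LinearMap.comp_apply, powProj_powIncl_of_ne this, map_zero,
        TensorProduct.zero_tmul, map_zero]
    · rfl
  · intro hn
    exact absurd (Finset.HasAntidiagonal.mem_antidiagonal.2 h.2.2) hn

/-- Cuts with an empty side are discarded, which matches the exclusion of chords between cyclically
adjacent positions. -/
theorem algCycCyc_powIncl_eq_zero {g k p q : ℕ} (h : p = 0 ∨ q = 0)
    (x : ⨂[ℚ]^p (H g)) (y : ⨂[ℚ]^q (H g)) :
    algCycCyc g k (powIncl g p x ⊗ₜ powIncl g q y) = 0 := by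
  rw [algCycCyc, LinearMap.sum_apply]
  refine Finset.sum_eq_zero ?_
  rintro ⟨p', q'⟩ -
  split_ifs with h'
  · simp only at h'
    rw [LinearMap.comp_apply, TensorProduct.map_tmul, algCyc, LinearMap.comp_apply, algCyc,
      LinearMap.comp_apply]
    rcases h with h | h
    · rw [powProj_powIncl_of_ne (by omega), map_zero, TensorProduct.zero_tmul, map_zero]
    · rw [powProj_powIncl_of_ne (n := q) (by omega), map_zero, TensorProduct.tmul_zero, map_zero]
  · rfl

theorem algCycCyc_mul_tmul_mul {g k : ℕ} (x x' y y' : TA g) :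
    algCycCyc g k ((x * x') ⊗ₜ (y * y')) = algCycCyc g k ((x' * x) ⊗ₜ (y' * y)) := by
  rw [algCycCyc, LinearMap.sum_apply, LinearMap.sum_apply]
  refine Finset.sum_congr rfl fun d _ => ?_
  split_ifs with h
  · rw [LinearMap.comp_apply, LinearMap.comp_apply, TensorProduct.map_tmul,
      TensorProduct.map_tmul, algCyc_mul_comm x, algCyc_mul_comm y]
  · rfl

/-! ### The twisted coproduct -/

/-- The composite `T(H) → T(H) ⊗ T(H)` of the coproduct with the antipode on the first
factor, as an algebra homomorphism to `T(H)ᵐᵒᵖ ⊗ T(H)`. -/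
def twistedCoprod (g : ℕ) : TA g →ₐ[ℚ] (TA g)ᵐᵒᵖ ⊗[ℚ] TA g :=
  TensorAlgebra.lift ℚ
    ((Algebra.TensorProduct.includeRight :
        TA g →ₐ[ℚ] (TA g)ᵐᵒᵖ ⊗[ℚ] TA g).toLinearMap ∘ₗ ι ℚ -
      (Algebra.TensorProduct.includeLeft :
        (TA g)ᵐᵒᵖ →ₐ[ℚ] (TA g)ᵐᵒᵖ ⊗[ℚ] TA g).toLinearMap ∘ₗ
          (MulOpposite.opLinearEquiv ℚ).toLinearMap ∘ₗ ι ℚ)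

theorem twistedCoprod_ι {g : ℕ} (x : H g) :
    twistedCoprod g (ι ℚ x) = 1 ⊗ₜ ι ℚ x - MulOpposite.op (ι ℚ x) ⊗ₜ 1 := by
  simp [twistedCoprod]

/-- Forgetting the opposite multiplication on the first factor. -/
def forgetOp (g : ℕ) : (TA g)ᵐᵒᵖ ⊗[ℚ] TA g →ₗ[ℚ] TA g ⊗[ℚ] TA g :=
  TensorProduct.map (MulOpposite.opLinearEquiv ℚ).symm.toLinearMap LinearMap.id

theorem forgetOp_tmul {g : ℕ} (x : (TA g)ᵐᵒᵖ) (y : TA g) :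
    forgetOp g (x ⊗ₜ y) = x.unop ⊗ₜ y := rfl

/-- Right multiplication in the opposite algebra is left multiplication in `T(H)`, so the new letter
lands on the outer side of each factor. -/
theorem forgetOp_mul_ι {g : ℕ} (z : (TA g)ᵐᵒᵖ ⊗[ℚ] TA g) (x : H g) :
    forgetOp g (z * (1 ⊗ₜ ι ℚ x - MulOpposite.op (ι ℚ x) ⊗ₜ 1)) =
      forgetOp g z * (1 ⊗ₜ ι ℚ x) - (ι ℚ x ⊗ₜ 1) * forgetOp g z := by
  induction z using TensorProduct.induction_on with
  | zero => simp
  | add y z hy hz => rw [add_mul, map_add, hy, hz, map_add, add_mul, mul_add]; abel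
  | tmul y z =>
    rw [mul_sub, map_sub]
    simp [forgetOp_tmul]

/-- A trace on `T(H)` is also one on its opposite, so reversing the products in the first factor
does no harm. -/
theorem algCycCyc_forgetOp_mul_comm {g k : ℕ} (z w : (TA g)ᵐᵒᵖ ⊗[ℚ] TA g) :
    algCycCyc g k (forgetOp g (z * w)) = algCycCyc g k (forgetOp g (w * z)) := by
  induction z using TensorProduct.induction_on with
  | zero => simp
  | add y z hy hz => rw [add_mul, mul_add, map_add, map_add, map_add, map_add, hy, hz]
  | tmul y z =>
    induction w using TensorProduct.induction_on with
    | zero => simp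
    | add y z hy hz => rw [add_mul, mul_add, map_add, map_add, map_add, map_add, hy, hz]
    | tmul y' z' =>
      rw [Algebra.TensorProduct.tmul_mul_tmul, Algebra.TensorProduct.tmul_mul_tmul, forgetOp_tmul,
        forgetOp_tmul, MulOpposite.unop_mul, MulOpposite.unop_mul, algCycCyc_mul_tmul_mul]

/-- The map `T(H) → ⨁ 𝓒(p) ⊗ 𝓒(q)` induced by the twisted coproduct. -/
def cycCoprod (g k : ℕ) : TA g →ₗ[ℚ] CycCyc g k :=
  algCycCyc g k ∘ₗ forgetOp g ∘ₗ (twistedCoprod g).toLinearMap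

theorem cycCoprod_apply {g k : ℕ} (x : TA g) :
    cycCoprod g k x = algCycCyc g k (forgetOp g (twistedCoprod g x)) := rfl

theorem cycCoprod_mul_comm {g k : ℕ} (x y : TA g) :
    cycCoprod g k (x * y) = cycCoprod g k (y * x) := by
  rw [cycCoprod_apply, cycCoprod_apply, map_mul (twistedCoprod g),
    map_mul (twistedCoprod g), algCycCyc_forgetOp_mul_comm]

/-- Each cyclic relation has the form `xy - yx` with `x` a letter, and `cycCoprod` vanishes on
commutators. -/
theorem cycCoprod_powIncl_eq_zero {g k m : ℕ} {x : ⨂[ℚ]^m (H g)} (hx : cycProj g m x = 0) :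
    cycCoprod g k (powIncl g m x) = 0 := by
  have hx' : x ∈ cyclicRel g m := (Submodule.Quotient.mk_eq_zero _).1 hx
  clear hx
  induction hx' using Submodule.span_induction with
  | zero => simp
  | add y z _ _ hy hz => rw [map_add, map_add, hy, hz, add_zero]
  | smul r y _ hy => rw [map_smul, map_smul, hy, smul_zero]
  | mem y hy =>
    obtain ⟨a, rfl⟩ := hy
    rw [map_sub, map_sub, sub_eq_zero]
    cases m with
    | zero => rfl
    | succ m =>
      obtain ⟨x, b, rfl⟩ : ∃ x b, a = (Fin.cons x b : Fin (m + 1) → H g) :=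
        ⟨a 0, Fin.tail a, (Fin.cons_self_tail a).symm⟩
      rw [← Fin.snoc_eq_cons_rotate, powIncl_tprod_cons, powIncl_tprod_snoc, cycCoprod_mul_comm]

/-! ### Double derivations of the tensor algebra -/

/-- The algebra homomorphism with diagonal entries `x ⊗ 1` and `1 ⊗ x` whose upper right entry is
the double derivation extending `f ∈ H*`. -/
def doubleMatrix {g : ℕ} (f : Module.Dual ℚ (H g)) :
    TA g →ₐ[ℚ] Matrix (Fin 2) (Fin 2) (TA g ⊗[ℚ] TA g) :=
  TensorAlgebra.lift ℚ
    { toFun := fun x => !![ι ℚ x ⊗ₜ 1, f x • 1; 0, 1 ⊗ₜ ι ℚ x]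
      map_add' := fun x y => by
        ext i j
        fin_cases i <;> fin_cases j <;>
          simp [TensorProduct.add_tmul, TensorProduct.tmul_add, add_smul]
      map_smul' := fun r x => by
        ext i j
        fin_cases i <;> fin_cases j <;>
          simp [TensorProduct.smul_tmul', mul_smul] }

theorem doubleMatrix_ι {g : ℕ} (f : Module.Dual ℚ (H g)) (x : H g) :
    doubleMatrix f (ι ℚ x) = !![ι ℚ x ⊗ₜ 1, f x • 1; 0, 1 ⊗ₜ ι ℚ x] := by
  simp [doubleMatrix]

/-- The double derivation `T(H) → T(H) ⊗ T(H)` extending `f ∈ H*`. -/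
def doubleDer {g : ℕ} (f : Module.Dual ℚ (H g)) : TA g →ₗ[ℚ] TA g ⊗[ℚ] TA g :=
  Matrix.entryLinearMap ℚ (TA g ⊗[ℚ] TA g) 0 1 ∘ₗ (doubleMatrix f).toLinearMap

theorem doubleDer_apply {g : ℕ} (f : Module.Dual ℚ (H g)) (x : TA g) :
    doubleDer f x = doubleMatrix f x 0 1 := rfl

theorem doubleMatrix_entries {g : ℕ} (f : Module.Dual ℚ (H g)) (x : TA g) :
    doubleMatrix f x 0 0 = x ⊗ₜ 1 ∧ doubleMatrix f x 1 1 = 1 ⊗ₜ x := by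
  -- The vanishing lower left entry is needed to make the diagonal multiplicative, so it joins the
  -- induction.
  suffices h : doubleMatrix f x 0 0 = x ⊗ₜ 1 ∧ doubleMatrix f x 1 1 = 1 ⊗ₜ x ∧
      doubleMatrix f x 1 0 = 0 from ⟨h.1, h.2.1⟩
  induction x using TensorAlgebra.induction with
  | algebraMap r =>
    simp [Algebra.algebraMap_eq_smul_one, Algebra.TensorProduct.one_def, TensorProduct.smul_tmul']
  | ι x => simp [doubleMatrix_ι]
  | mul x y hx hy =>
    simp [Matrix.mul_apply, Fin.sum_univ_two, hx, hy]
  | add x y hx hy =>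
    simp [hx, hy, TensorProduct.add_tmul, TensorProduct.tmul_add]

theorem doubleDer_ι {g : ℕ} (f : Module.Dual ℚ (H g)) (x : H g) :
    doubleDer f (ι ℚ x) = f x • 1 := by
  simp [doubleDer_apply, doubleMatrix_ι]

/-- This Leibniz rule is the upper right entry of a product of triangular matrices. -/
theorem doubleDer_mul {g : ℕ} (f : Module.Dual ℚ (H g)) (x y : TA g) :
    doubleDer f (x * y) = (x ⊗ₜ 1) * doubleDer f y + doubleDer f x * (1 ⊗ₜ y) := by
  simp only [doubleDer_apply, map_mul, Matrix.mul_apply, Fin.sum_univ_two,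
    doubleMatrix_entries f x, doubleMatrix_entries f y]

theorem doubleDer_word {g : ℕ} (f : Module.Dual ℚ (H g)) (b : ℕ → H g) (s m : ℕ) :
    doubleDer f (word b s m) = ∑ n ∈ Finset.range m,
      f (b (s + n)) • (word b s n ⊗ₜ[ℚ] word b (s + n + 1) (m - (n + 1))) := by
  induction m with
  | zero =>
    -- Leibniz on `1 * 1` forces the derivation to kill `1`.
    have h := doubleDer_mul f 1 1
    rw [mul_one, ← Algebra.TensorProduct.one_def, one_mul, mul_one, left_eq_add] at h
    rw [word_zero, h, Finset.sum_range_zero]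
  | succ m ih =>
    rw [word_succ, doubleDer_mul, ih, Finset.sum_range_succ, doubleDer_ι, Finset.sum_mul, add_comm]
    congr 1
    · refine Finset.sum_congr rfl fun n hn => ?_
      have hn := Finset.mem_range.1 hn
      rw [show m + 1 - (n + 1) = m - (n + 1) + 1 by omega, word_succ,
        show s + n + 1 + (m - (n + 1)) = s + m by omega, smul_mul_assoc,
        Algebra.TensorProduct.tmul_mul_tmul, mul_one]
    · rw [Nat.sub_self, word_zero, mul_smul_comm, mul_one]

/-! ### Contraction of the first letter as an augmented double derivation. -/

/-- The map `ε ⊗ 1 : T(H) ⊗ T(H) → T(H)`, where `ε` is the augmentation. -/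
def augLeft (g : ℕ) : TA g ⊗[ℚ] TA g →ₐ[ℚ] TA g :=
  (Algebra.TensorProduct.lid ℚ (TA g)).toAlgHom.comp
    (Algebra.TensorProduct.map TensorAlgebra.algebraMapInv (AlgHom.id ℚ (TA g)))

theorem augLeft_tmul {g : ℕ} (x y : TA g) :
    augLeft g (x ⊗ₜ y) = TensorAlgebra.algebraMapInv x • y := by
  simp [augLeft]

theorem algebraMapInv_ι {g : ℕ} (x : H g) :
    (TensorAlgebra.algebraMapInv : TA g →ₐ[ℚ] ℚ) (ι ℚ x) = 0 := by
  simp [TensorAlgebra.algebraMapInv]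

/-- The augmentation kills every cut whose left piece is nonempty, leaving the cut at the first
letter. -/
theorem augLeft_doubleDer_word {g : ℕ} (f : Module.Dual ℚ (H g)) (b : ℕ → H g) (s m : ℕ) :
    augLeft g (doubleDer f (word b s (m + 1))) = f (b s) • word b (s + 1) m := by
  rw [doubleDer_word, map_sum, Finset.sum_eq_single 0]
  · rw [map_smul, augLeft_tmul, word_zero, map_one, one_smul]
    rfl
  · rintro (_ | n) - hn
    · exact absurd rfl hn
    · rw [map_smul, augLeft_tmul, word_succ, map_mul, algebraMapInv_ι, mul_zero, zero_smul,
        smul_zero]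
  · intro h
    exact absurd (Finset.mem_range.2 (Nat.succ_pos m)) h

theorem powIncl_contract {g k : ℕ} (f : Module.Dual ℚ (H g)) (v : ⨂[ℚ]^(k + 1) (H g)) :
    powIncl g k (contract g k (f ⊗ₜ v)) = augLeft g (doubleDer f (powIncl g (k + 1) v)) := by
  induction v using PiTensorProduct.induction_on with
  | add v w hv hw => simp only [TensorProduct.tmul_add, map_add, hv, hw]
  | smul_tprod r a =>
    simp only [TensorProduct.tmul_smul, map_smul]
    congr 1
    -- Words are indexed by `ℕ`; the value `0` beyond the range is never read.
    let b : ℕ → H g := fun n => if h : n < k + 1 then a ⟨n, h⟩ else 0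
    have h1 : powIncl g (k + 1) (PiTensorProduct.tprod ℚ a) = word b 0 (k + 1) := by
      rw [word]
      congr 2
      funext t
      simp [b, Nat.not_lt.2 (Nat.le_of_lt_succ t.2)]
    have h2 : powIncl g k (PiTensorProduct.tprod ℚ fun i : Fin k => a i.succ) = word b 1 k := by
      rw [word]
      congr 2
      funext t
      simp [b, add_comm 1, Fin.succ]
    rw [contract_tmul_tprod, map_smul, h1, h2, augLeft_doubleDer_word]
    simp [b]

/-! ### Lie elements -/

section

attribute [local instance] LieRing.ofAssociativeRing

theorem lieToTensor_lie {g : ℕ} (u v : FreeLie g) :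
    lieToTensor g ⁅u, v⁆ =
      lieToTensor g u * lieToTensor g v - lieToTensor g v * lieToTensor g u :=
  LieHom.map_lie (FreeLieAlgebra.lift ℚ (fun i => TensorAlgebra.ι ℚ (Pi.single i 1 : H g)) :
    FreeLie g →ₗ⁅ℚ⁆ TensorAlgebra ℚ (H g)) u v

theorem lieToTensor_gen {g : ℕ} (x : H g) : lieToTensor g (gen g x) = ι ℚ x := by
  have : lieToTensor g ∘ₗ gen g = ι ℚ := by
    refine (Pi.basisFun ℚ (Fin (2 * g))).ext fun i => ?_
    rw [LinearMap.comp_apply, gen, Module.Basis.constr_basis, Pi.basisFun_apply]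
    exact FreeLieAlgebra.lift_of_apply (R := ℚ) _ i
  exact LinearMap.congr_fun this x

end

/-- Induction over the homogeneous components of the free Lie algebra. -/
theorem lieDeg_induction {g : ℕ} {p : ℕ → Submodule ℚ (FreeLie g)}
    (hgen : ∀ x, gen g x ∈ p 1) (hlie : ∀ m, ∀ u ∈ p m, ∀ x, ⁅u, gen g x⁆ ∈ p (m + 1)) (m : ℕ) :
    lieDeg g m ≤ p m := by
  induction m with
  | zero => exact bot_le
  | succ m ih =>
    cases m with
    | zero =>
      rintro _ ⟨x, rfl⟩
      exact hgen x
    | succ m =>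
      refine Submodule.span_le.2 ?_
      rintro _ ⟨u, hu, x, rfl⟩
      exact hlie _ u (ih hu) x

theorem powIncl_mul_ι_mem {g m : ℕ} (v : ⨂[ℚ]^m (H g)) (x : H g) :
    powIncl g m v * ι ℚ x ∈ LinearMap.range (powIncl g (m + 1)) ∧
      ι ℚ x * powIncl g m v ∈ LinearMap.range (powIncl g (m + 1)) := by
  induction v using PiTensorProduct.induction_on with
  | add v w hv hw =>
    rw [map_add, add_mul, mul_add]
    exact ⟨add_mem hv.1 hw.1, add_mem hv.2 hw.2⟩
  | smul_tprod r a =>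
    rw [map_smul, smul_mul_assoc, mul_smul_comm, ← powIncl_tprod_cons, ← powIncl_tprod_snoc]
    exact ⟨Submodule.smul_mem _ _ ⟨_, rfl⟩, Submodule.smul_mem _ _ ⟨_, rfl⟩⟩

theorem lieToTensor_mem_range {g m : ℕ} {u : FreeLie g} (hu : u ∈ lieDeg g m) :
    lieToTensor g u ∈ LinearMap.range (powIncl g m) := by
  refine lieDeg_induction
    (p := fun m => (LinearMap.range (powIncl g m)).comap (lieToTensor g)) ?_ ?_ m hu
  · intro x
    refine ⟨PiTensorProduct.tprod ℚ fun _ => x, ?_⟩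
    rw [powIncl_tprod, lieToTensor_gen]
    simp
  · rintro m u ⟨v, hv⟩ x
    rw [Submodule.mem_comap, lieToTensor_lie, lieToTensor_gen, ← hv]
    exact sub_mem (powIncl_mul_ι_mem v x).1 (powIncl_mul_ι_mem v x).2

theorem powIncl_lieEmb {g m : ℕ} (u : lieDeg g m) :
    powIncl g m (lieEmb g m u) = lieToTensor g u := by
  obtain ⟨v, hv⟩ := lieToTensor_mem_range u.2
  have : lieEmb g m u = powProj g m (lieToTensor g u) := rfl
  rw [this, ← hv, powProj_powIncl]

theorem algebraMapInv_lieToTensor {g m : ℕ} {u : FreeLie g} (hu : u ∈ lieDeg g m) :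
    (TensorAlgebra.algebraMapInv : TA g →ₐ[ℚ] ℚ) (lieToTensor g u) = 0 := by
  refine lieDeg_induction (p := fun _ => LinearMap.ker
    ((TensorAlgebra.algebraMapInv : TA g →ₐ[ℚ] ℚ).toLinearMap ∘ₗ lieToTensor g)) ?_ ?_ m hu
  · intro x
    simp [lieToTensor_gen, algebraMapInv_ι]
  · intro m u _ x
    simp [lieToTensor_lie, lieToTensor_gen, algebraMapInv_ι]

/-- Lie elements are primitive and the antipode negates them: in a bracket the cross terms cancel.
-/
theorem twistedCoprod_lieToTensor {g m : ℕ} {u : FreeLie g} (hu : u ∈ lieDeg g m) :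
    twistedCoprod g (lieToTensor g u) =
      1 ⊗ₜ lieToTensor g u - MulOpposite.op (lieToTensor g u) ⊗ₜ 1 := by
  let q : TA g →ₗ[ℚ] (TA g)ᵐᵒᵖ ⊗[ℚ] TA g :=
    (twistedCoprod g).toLinearMap - (TensorProduct.mk ℚ (TA g)ᵐᵒᵖ (TA g) 1 -
      (TensorProduct.mk ℚ (TA g)ᵐᵒᵖ (TA g)).flip 1 ∘ₗ
        (MulOpposite.opLinearEquiv ℚ).toLinearMap)
  have hq : ∀ u, u ∈ LinearMap.ker (q ∘ₗ lieToTensor g) ↔ twistedCoprod g (lieToTensor g u) =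
      1 ⊗ₜ lieToTensor g u - MulOpposite.op (lieToTensor g u) ⊗ₜ 1 := fun u =>
    LinearMap.mem_ker.trans sub_eq_zero
  rw [← hq]
  refine lieDeg_induction (p := fun _ => LinearMap.ker (q ∘ₗ lieToTensor g)) ?_ ?_ m hu
  · intro x
    rw [hq, lieToTensor_gen, twistedCoprod_ι]
  · intro m u hu x
    rw [hq] at hu ⊢
    rw [lieToTensor_lie, lieToTensor_gen, map_sub, map_mul, map_mul, hu, twistedCoprod_ι]
    simp only [mul_sub, sub_mul, Algebra.TensorProduct.tmul_mul_tmul, mul_one, one_mul,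
      TensorProduct.tmul_sub, TensorProduct.sub_tmul, MulOpposite.op_sub, MulOpposite.op_mul]
    abel

/-- On Lie elements a double derivation is determined by the contraction of the first letter. -/
theorem doubleDer_lieToTensor {g m : ℕ} (f : Module.Dual ℚ (H g)) {u : FreeLie g}
    (hu : u ∈ lieDeg g m) :
    doubleDer f (lieToTensor g u) =
      forgetOp g (twistedCoprod g (augLeft g (doubleDer f (lieToTensor g u)))) := by
  let q : TA g →ₗ[ℚ] TA g ⊗[ℚ] TA g :=
    doubleDer f - forgetOp g ∘ₗ (twistedCoprod g).toLinearMap ∘ₗ (augLeft g).toLinearMap ∘ₗ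
      doubleDer f
  have hq : ∀ u, u ∈ LinearMap.ker (q ∘ₗ lieToTensor g) ↔ doubleDer f (lieToTensor g u) =
      forgetOp g (twistedCoprod g (augLeft g (doubleDer f (lieToTensor g u)))) := fun u =>
    LinearMap.mem_ker.trans sub_eq_zero
  rw [← hq]
  -- Homogeneity is carried along because the inductive step needs `u` to be primitive and without
  -- constant term.
  refine (Submodule.mem_inf.1 (lieDeg_induction
    (p := fun m => lieDeg g m ⊓ LinearMap.ker (q ∘ₗ lieToTensor g)) ?_ ?_ m hu)).2
  · intro x
    refine ⟨⟨x, rfl⟩, (hq _).2 ?_⟩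
    rw [lieToTensor_gen, doubleDer_ι, map_smul, map_smul, map_smul, map_one, map_one]
    rfl
  · rintro (_ | m) u ⟨hm, hu⟩ x
    · rw [(Submodule.mem_bot ℚ).1 hm, zero_lie]
      exact zero_mem _
    refine ⟨Submodule.subset_span ⟨u, hm, x, rfl⟩, (hq _).2 ?_⟩
    have hu := (hq _).1 hu
    -- Of the four Leibniz terms of `ux - xu`, the two whose left factor gains `u` or `x` die under
    -- the augmentation.
    have h1 : augLeft g (doubleDer f (lieToTensor g ⁅u, gen g x⁆)) =
        augLeft g (doubleDer f (lieToTensor g u)) * ι ℚ x - f x • lieToTensor g u := by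
      rw [lieToTensor_lie, lieToTensor_gen, map_sub, doubleDer_mul, doubleDer_mul, doubleDer_ι,
        map_sub, map_add, map_add, map_mul, map_mul, map_mul, map_mul, augLeft_tmul, augLeft_tmul,
        augLeft_tmul, augLeft_tmul, algebraMapInv_ι, algebraMapInv_lieToTensor hm]
      simp
    have h2 : forgetOp g (twistedCoprod g (lieToTensor g u)) =
        1 ⊗ₜ lieToTensor g u - lieToTensor g u ⊗ₜ 1 := by
      rw [twistedCoprod_lieToTensor hm, map_sub]
      rfl
    rw [h1, map_sub (twistedCoprod g), map_mul (twistedCoprod g), twistedCoprod_ι, map_sub,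
      forgetOp_mul_ι, ← hu, map_smul, map_smul, h2, lieToTensor_lie, lieToTensor_gen, map_sub,
      doubleDer_mul, doubleDer_mul, doubleDer_ι]
    simp only [mul_smul_comm, smul_mul_assoc, mul_one, one_mul, smul_sub]
    abel

theorem algCycCyc_doubleDer_lieEmb {g k : ℕ} (f : Module.Dual ℚ (H g)) (u : lieDeg g (k + 1)) :
    algCycCyc g k (doubleDer f (powIncl g (k + 1) (lieEmb g (k + 1) u))) =
      cycCoprod g k (powIncl g k (contract g k (f ⊗ₜ lieEmb g (k + 1) u))) := by
  rw [powIncl_contract, powIncl_lieEmb, cycCoprod_apply, ← doubleDer_lieToTensor f u.2]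

/-! ### Antisymmetry of the intersection form. -/

theorem J_swap (g : ℕ) (i j : Fin (2 * g)) : J g i j = -J g j i := by
  simp only [J, Matrix.of_apply, Fin.ext_iff, Fin.val_rev]
  have := i.2
  have := j.2
  split_ifs <;> first | omega | norm_num

theorem interForm_swap {g : ℕ} (x y : H g) : interForm g x y = -interForm g y x := by
  simp only [interForm, Matrix.toBilin'_apply]
  rw [Finset.sum_comm, ← Finset.sum_neg_distrib]
  refine Finset.sum_congr rfl fun i _ => ?_
  rw [← Finset.sum_neg_distrib]
  refine Finset.sum_congr rfl fun j _ => ?_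
  rw [J_swap g j i]
  ring

theorem interForm_self {g : ℕ} (x : H g) : interForm g x x = 0 :=
  self_eq_neg.1 (interForm_swap x x)

/-! ### Rotations -/

/-- The rotation `a₁ ⊗ a₂ ⊗ ⋯ ⊗ a_m ↦ a₂ ⊗ ⋯ ⊗ a_m ⊗ a₁`. -/
def rot (g m : ℕ) : Module.End ℚ (⨂[ℚ]^m (H g)) :=
  (PiTensorProduct.reindex ℚ (fun _ => H g) (finRotate m).symm).toLinearMap

theorem rot_tprod {g m : ℕ} (a : Fin m → H g) :
    rot g m (PiTensorProduct.tprod ℚ a) = PiTensorProduct.tprod ℚ fun i => a (finRotate m i) := by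
  simp [rot]

theorem rot_pow_tprod {g k : ℕ} (a : Fin (k + 2) → H g) (n : ℕ) :
    (rot g (k + 2) ^ n) (PiTensorProduct.tprod ℚ a) =
      PiTensorProduct.tprod ℚ fun t => a (Fin.ofNat (k + 2) n + t) := by
  induction n generalizing a with
  | zero => simp
  | succ n ih =>
    rw [pow_succ, Module.End.mul_apply, rot_tprod, ih]
    congr 1
    funext t
    rw [finRotate_apply]
    congr 1
    ext
    simp only [Fin.val_add, Fin.val_ofNat, Fin.val_one]
    simp only [Nat.mod_add_mod]
    congr 1
    omega

theorem powIncl_consTensor {g m : ℕ} (x : H g) (v : ⨂[ℚ]^m (H g)) :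
    powIncl g (m + 1) (consTensor g m (x ⊗ₜ v)) = ι ℚ x * powIncl g m v := by
  induction v using PiTensorProduct.induction_on with
  | add v w hv hw => simp only [TensorProduct.tmul_add, map_add, hv, hw, mul_add]
  | smul_tprod r a =>
    simp only [TensorProduct.tmul_smul, map_smul, mul_smul_comm]
    rw [consTensor_tmul_tprod, powIncl_tprod_cons]

theorem powIncl_rot_consTensor {g m : ℕ} (x : H g) (v : ⨂[ℚ]^m (H g)) :
    powIncl g (m + 1) (rot g (m + 1) (consTensor g m (x ⊗ₜ v))) = powIncl g m v * ι ℚ x := by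
  induction v using PiTensorProduct.induction_on with
  | add v w hv hw => simp only [TensorProduct.tmul_add, map_add, hv, hw, add_mul]
  | smul_tprod r a =>
    simp only [TensorProduct.tmul_smul, map_smul, smul_mul_assoc]
    rw [consTensor_tmul_tprod, rot_tprod, ← Fin.snoc_eq_cons_rotate, powIncl_tprod_snoc]

/-- Symplectic derivations are rotation invariant tensors. -/
theorem rot_symplDer {g k : ℕ} {x : H g ⊗[ℚ] lieDeg g (k + 1)} (hx : x ∈ symplDer g k) :
    rot g (k + 2) (consTensor g (k + 1) (TensorProduct.map LinearMap.id (lieEmb g (k + 1)) x)) =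
      consTensor g (k + 1) (TensorProduct.map LinearMap.id (lieEmb g (k + 1)) x) := by
  -- In the tensor algebra `[X, u] = Xu - uX`, and `uX` is the rotation of `Xu`.
  have key : lieToTensor g (bracketMap g k x) =
      powIncl g (k + 2) (consTensor g (k + 1)
        (TensorProduct.map LinearMap.id (lieEmb g (k + 1)) x)) -
      powIncl g (k + 2) (rot g (k + 2) (consTensor g (k + 1)
        (TensorProduct.map LinearMap.id (lieEmb g (k + 1)) x))) := by
    clear hx
    induction x using TensorProduct.induction_on with
    | zero => simp
    | add x y hx hy => simp only [map_add, hx, hy]; abel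
    | tmul x u =>
      have : bracketMap g k (x ⊗ₜ u) = ⁅gen g x, (u : FreeLie g)⁆ := rfl
      rw [this, lieToTensor_lie, lieToTensor_gen, TensorProduct.map_tmul, LinearMap.id_apply,
        powIncl_consTensor, powIncl_rot_consTensor, powIncl_lieEmb]
  rw [LinearMap.mem_ker.1 hx, map_zero, eq_comm, sub_eq_zero] at key
  exact (powIncl_injective g (k + 2) key).symm

/-! ### The Kawazumi–Kuno map on rotation invariant tensors -/

theorem powIncl_tprod_eq_word {g n n' : ℕ} {v : Fin n → H g} {b : ℕ → H g} {s : ℕ} (hn : n = n')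
    (h : ∀ t, v t = b (s + t)) : powIncl g n (PiTensorProduct.tprod ℚ v) = word b s n' := by
  subst hn
  rw [word]
  congr 2
  exact funext h

/-- The periodic sequence attached to a family indexed by `Fin (k + 2)`. -/
def periodic {g k : ℕ} (a : Fin (k + 2) → H g) (t : ℕ) : H g := a (Fin.ofNat (k + 2) t)

/-- The contribution of the chord from `0` to `n` to the Kawazumi–Kuno map. -/
def arcTerm {g k : ℕ} (a : Fin (k + 2) → H g) (n : Fin (k + 2)) : CycCyc g k :=
  interForm g (a 0) (a n) • algCycCyc g k
    (word (periodic a) 1 (n - 1) ⊗ₜ word (periodic a) (n + 1) (k + 1 - n))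

/-- At `n = 0` the form is alternating, which also makes the truncated `n - 1` harmless; at `n = 1`
and `n = k + 1` one of the two words is empty. -/
theorem arcTerm_eq_zero {g k : ℕ} (a : Fin (k + 2) → H g) {n : Fin (k + 2)}
    (hn : ¬(1 < (n : ℕ) ∧ (n : ℕ) < k + 1)) : arcTerm a n = 0 := by
  rcases eq_or_ne n 0 with rfl | h0
  · rw [arcTerm, interForm_self, zero_smul]
  · have : (n : ℕ) ≠ 0 := fun h => h0 (Fin.ext h)
    rw [arcTerm, word, word, algCycCyc_powIncl_eq_zero (by omega), smul_zero]

theorem cycIncl_chord {g k : ℕ} (c : Chord k) (a : Fin (k + 2) → H g) :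
    interForm g (a c.1.1) (a c.1.2) • cycIncl g c.lens
      (cycProj g c.inLen (PiTensorProduct.tprod ℚ fun t => a (c.inPos t)) ⊗ₜ[ℚ]
        cycProj g c.outLen (PiTensorProduct.tprod ℚ fun t => a (c.outPos t))) =
      arcTerm (fun t => a (c.1.1 + t)) (c.1.2 - c.1.1) := by
  obtain ⟨⟨i, j⟩, h1, h2, h3⟩ := c
  have hd : ((j - i : Fin (k + 2)) : ℕ) = j - i := Fin.sub_val_of_le h1.le
  have hi := i.2
  have hj := j.2
  simp only at h1 h2 h3
  rw [← algCycCyc_powIncl, arcTerm, add_zero, add_sub_cancel]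
  congr 3
  · refine powIncl_tprod_eq_word (by rw [hd, Chord.inLen]) fun t => ?_
    have ht := t.2
    simp only [Chord.inLen] at ht
    simp only [periodic]
    congr 1
    ext
    simp only [Chord.inPos, Fin.val_add, Fin.val_ofNat, Nat.add_mod_mod]
    rw [Nat.mod_eq_of_lt (by omega)]
    omega
  · refine powIncl_tprod_eq_word (by rw [hd, Chord.outLen]) fun t => ?_
    have ht := t.2
    simp only [Chord.outLen] at ht
    simp only [periodic]
    congr 1
    ext
    simp only [Chord.outPos, Fin.val_add, Fin.val_ofNat, Nat.add_mod_mod, hd]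
    split_ifs
    · rw [Nat.mod_eq_of_lt (by omega)]
      omega
    · rw [Nat.mod_eq_sub_mod (by omega), Nat.mod_eq_of_lt (by omega)]
      omega

/-- Read from `j`, the chord has the outer word first; the sign comes from exchanging the arguments
of the form. Thus the subtracted term of the Kawazumi–Kuno map is the same chord with reversed
orientation, counted positively. -/
theorem cycIncl_chord_swap {g k : ℕ} (c : Chord k) (a : Fin (k + 2) → H g) :
    interForm g (a c.1.1) (a c.1.2) • cycIncl g c.lens_swap
      (cycProj g c.outLen (PiTensorProduct.tprod ℚ fun t => a (c.outPos t)) ⊗ₜ[ℚ]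
        cycProj g c.inLen (PiTensorProduct.tprod ℚ fun t => a (c.inPos t))) =
      -arcTerm (fun t => a (c.1.2 + t)) (c.1.1 - c.1.2) := by
  obtain ⟨⟨i, j⟩, h1, h2, h3⟩ := c
  have hi := i.2
  have hj := j.2
  have hd : ((i - j : Fin (k + 2)) : ℕ) = k + 2 + i - j := by
    rw [Fin.coe_sub_iff_lt.2 h1]
  simp only at h1 h2 h3
  have h1' : (i : ℕ) < j := h1
  rw [← algCycCyc_powIncl, arcTerm, add_zero, add_sub_cancel, interForm_swap]
  refine (neg_smul (R := ℚ) (M := CycCyc g k) _ _).trans (congrArg Neg.neg ?_)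
  congr 3
  · refine powIncl_tprod_eq_word (by rw [hd, Chord.outLen]; simp only; omega) fun t => ?_
    have ht := t.2
    simp only [Chord.outLen] at ht
    simp only [periodic]
    congr 1
    ext
    simp only [Chord.outPos, Fin.val_add, Fin.val_ofNat, Nat.add_mod_mod]
    split_ifs
    · rw [Nat.mod_eq_of_lt (by omega)]
      omega
    · rw [Nat.mod_eq_sub_mod (by omega), Nat.mod_eq_of_lt (by omega)]
      omega
  · refine powIncl_tprod_eq_word (by rw [hd, Chord.inLen]; simp only; omega) fun t => ?_
    have ht := t.2
    simp only [Chord.inLen] at ht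
    simp only [periodic]
    congr 1
    ext
    simp only [Chord.inPos, Fin.val_add, Fin.val_ofNat, Nat.add_mod_mod, hd]
    rw [Nat.mod_eq_sub_mod (by omega), Nat.mod_eq_of_lt (by omega)]
    omega

theorem deltaTensor_tprod_eq_sum_arcTerm {g k : ℕ} (a : Fin (k + 2) → H g) :
    deltaTensor g k (PiTensorProduct.tprod ℚ a) =
      ∑ i : Fin (k + 2), ∑ n : Fin (k + 2), arcTerm (fun t => a (i + t)) n := by
  let F : Fin (k + 2) × Fin (k + 2) → CycCyc g k :=
    fun p => arcTerm (fun t => a (p.1 + t)) (p.2 - p.1)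
  let S : Fin (k + 2) × Fin (k + 2) → Prop :=
    fun p => p.1 < p.2 ∧ 1 < (p.2 : ℕ) - (p.1 : ℕ) ∧ (p.2 : ℕ) - (p.1 : ℕ) < k + 1
  -- An ordered pair is an admissible chord in exactly one orientation, or else contributes zero.
  have hF : ∀ p, F p = (if S p then F p else 0) + (if S p.swap then F p else 0) := by
    rintro ⟨i, j⟩
    have hi := i.2
    have hj := j.2
    rcases lt_trichotomy i j with h | rfl | h
    · have hd : ((j - i : Fin (k + 2)) : ℕ) = j - i := Fin.sub_val_of_le h.le
      rw [if_neg (c := S (Prod.swap (i, j))) fun h' => lt_asymm h h'.1, add_zero]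
      split_ifs with h'
      · rfl
      · exact arcTerm_eq_zero _ fun h'' => h' ⟨h, by simpa only [hd] using h''⟩
    · rw [if_neg fun h' => lt_irrefl _ h'.1, if_neg fun h' => lt_irrefl _ h'.1, add_zero]
      exact arcTerm_eq_zero _ (by simp)
    · have hd : ((i - j : Fin (k + 2)) : ℕ) = i - j := Fin.sub_val_of_le h.le
      have hd' : ((j - i : Fin (k + 2)) : ℕ) = k + 2 + j - i := by
        rw [Fin.coe_sub_iff_lt.2 h]
      rw [if_neg (c := S (i, j)) fun h' => lt_asymm h h'.1, zero_add]
      split_ifs with h'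
      · rfl
      · refine arcTerm_eq_zero _ fun h'' => h' ⟨h, ?_⟩
        simp only [hd', Prod.swap] at h'' ⊢
        omega
  have h1 : ∑ i : Fin (k + 2), ∑ n : Fin (k + 2), arcTerm (fun t => a (i + t)) n =
      ∑ p, F p := by
    rw [Fintype.sum_prod_type]
    -- For fixed `i`, the offset `n` is replaced by the endpoint `j = i + n` modulo `k + 2`.
    exact Finset.sum_congr rfl fun i _ => (Equiv.sum_comp (Equiv.subRight i) _).symm
  have h2 : ∑ p, (if S p.swap then F p else 0) = ∑ p, if S p then F p.swap else 0 :=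
    (Equiv.sum_comp (Equiv.prodComm _ _) _).symm
  rw [h1, Finset.sum_congr rfl fun p _ => hF p, Finset.sum_add_distrib, h2,
    ← Finset.sum_add_distrib]
  simp only [ite_add_ite, add_zero]
  rw [← Finset.sum_filter, deltaTensor_tprod]
  rw [Finset.sum_subtype (p := S) _ (by simp)]
  refine Finset.sum_congr rfl fun c _ => ?_
  rw [smul_sub, cycIncl_chord, cycIncl_chord_swap, sub_neg_eq_add]
  rfl

/-- The part of the Kawazumi–Kuno map given by the chords issuing from the first position. -/
def deltaFirst (g k : ℕ) : ⨂[ℚ]^(k + 2) (H g) →ₗ[ℚ] CycCyc g k :=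
  ∑ n : Fin (k + 2), if h : 1 < (n : ℕ) ∧ (n : ℕ) < k + 1 then
    let c : Chord k := ⟨(0, n), Fin.lt_def.2 (by simp only [Fin.val_zero]; omega), h⟩
    cycIncl g c.lens ∘ₗ PiTensorProduct.lift (chordTerm g c) else 0

theorem deltaFirst_tprod {g k : ℕ} (a : Fin (k + 2) → H g) :
    deltaFirst g k (PiTensorProduct.tprod ℚ a) = ∑ n, arcTerm a n := by
  rw [deltaFirst, LinearMap.sum_apply]
  refine Finset.sum_congr rfl fun n _ => ?_
  split_ifs with h
  · rw [LinearMap.comp_apply, PiTensorProduct.lift.tprod, chordTerm_apply, map_smul, cycIncl_chord]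
    simp only [zero_add, sub_zero]
  · rw [arcTerm_eq_zero a h, LinearMap.zero_apply]

theorem deltaTensor_eq_sum_rot (g k : ℕ) :
    deltaTensor g k = ∑ i : Fin (k + 2), deltaFirst g k ∘ₗ rot g (k + 2) ^ (i : ℕ) := by
  refine PiTensorProduct.ext (MultilinearMap.ext fun a => ?_)
  simp only [LinearMap.compMultilinearMap_apply, LinearMap.sum_apply, LinearMap.comp_apply,
    rot_pow_tprod, deltaFirst_tprod, deltaTensor_tprod_eq_sum_arcTerm]
  simp

theorem deltaTensor_of_rot_eq {g k : ℕ} {y : ⨂[ℚ]^(k + 2) (H g)} (hy : rot g (k + 2) y = y) :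
    deltaTensor g k y = (k + 2) • deltaFirst g k y := by
  have h : ∀ n : ℕ, (rot g (k + 2) ^ n) y = y := fun n => by
    induction n with
    | zero => rfl
    | succ n ih => rw [pow_succ, Module.End.mul_apply, hy, ih]
  simp [deltaTensor_eq_sum_rot, h]

/-- Both sides cut the word after `x` at one letter, weighted by that letter's pairing with `x`. The
sum on the right also runs over cuts at the end letters, whose terms are zero. -/
theorem deltaFirst_consTensor {g k : ℕ} (x : H g) (v : ⨂[ℚ]^(k + 1) (H g)) :
    deltaFirst g k (consTensor g (k + 1) (x ⊗ₜ v)) =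
      algCycCyc g k (doubleDer (interForm g x) (powIncl g (k + 1) v)) := by
  induction v using PiTensorProduct.induction_on with
  | add v w hv hw => simp only [TensorProduct.tmul_add, map_add, hv, hw]
  | smul_tprod r a =>
    simp only [TensorProduct.tmul_smul, map_smul]
    congr 1
    have hw : powIncl g (k + 1) (PiTensorProduct.tprod ℚ a) =
        word (periodic (Fin.cons x a : Fin (k + 2) → H g)) 1 (k + 1) := by
      refine powIncl_tprod_eq_word rfl fun t => ?_
      have : Fin.ofNat (k + 2) (1 + t) = t.succ := by
        ext
        simp only [Fin.val_ofNat, Fin.val_succ]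
        rw [Nat.mod_eq_of_lt (by omega), add_comm]
      rw [periodic, this, Fin.cons_succ]
    rw [consTensor_tmul_tprod, deltaFirst_tprod, hw, doubleDer_word, map_sum, Fin.sum_univ_succ,
      arcTerm_eq_zero _ (by simp), zero_add, Finset.sum_range]
    refine Finset.sum_congr rfl fun n _ => ?_
    have : Fin.ofNat (k + 2) (1 + n) = n.succ := by
      ext
      simp only [Fin.val_ofNat, Fin.val_succ]
      rw [Nat.mod_eq_of_lt (by omega), add_comm]
    rw [arcTerm, map_smul, Fin.cons_zero, Fin.val_succ, Nat.add_sub_cancel, periodic, this,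
      add_comm 1 (n : ℕ)]

/-! ### Factorization of the Kawazumi–Kuno map through the trace. -/

theorem deltaAlg_eq {g k : ℕ} (x : symplDer g k) :
    deltaAlg g k x = (k + 2) • cycCoprod g k (powIncl g k (contract g k
      (TensorProduct.map (interForm g) (lieEmb g (k + 1)) x.1))) := by
  have h : ∀ z : H g ⊗[ℚ] lieDeg g (k + 1),
      deltaFirst g k (consTensor g (k + 1)
        (TensorProduct.map LinearMap.id (lieEmb g (k + 1)) z)) =
      cycCoprod g k (powIncl g k (contract g k
        (TensorProduct.map (interForm g) (lieEmb g (k + 1)) z))) := fun z => by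
    induction z using TensorProduct.induction_on with
    | zero => simp
    | add y z hy hz => simp only [map_add, hy, hz]
    | tmul y u =>
      rw [TensorProduct.map_tmul, TensorProduct.map_tmul, LinearMap.id_apply,
        deltaFirst_consTensor, algCycCyc_doubleDer_lieEmb]
  rw [← h, ← deltaTensor_of_rot_eq (rot_symplDer x.2)]
  rfl

end JohnsonCokernel

end

theorem theorem1 (g k : ℕ) (hk : 1 ≤ k) (hg : k + 2 ≤ 2 * g) :
    LinearMap.ker (JohnsonCokernel.traceMap g k) ≤
      LinearMap.ker (JohnsonCokernel.deltaAlg g k) := by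
  intro x hx
  have h := JohnsonCokernel.cycCoprod_powIncl_eq_zero (k := k) (LinearMap.mem_ker.1 hx)
  simp only [LinearMap.comp_apply, Submodule.subtype_apply] at h
  rw [LinearMap.mem_ker, JohnsonCokernel.deltaAlg_eq, h, smul_zero]
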